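/- **Setting.** Let $Q$ be a finite set (of modes), $T=[0,\infty)$, and let $PC(T,\mathbb{R}^m)$ be the set of maps $T\to\mathbb{R}^m$ which have finitely many discontinuities on every $[0,t]$, with finite one-sided limits at them. Let $(Q\times T)^+$ be the set of non-empty finite sequences $(q_1,t_1)\cdots(q_k,t_k)$ with $q_i\in Q$, $t_i\in T$ (switching sequences), and let $Q^*$ be the set of finite words over $Q$, including the empty word $\epsilon$. An *input-output map* is a map $f:PC(T,\mathbb{R}^m)\times(Q\times T)^+\to\mathbb{R}^p$. Let $\Phi$ be a non-empty set of input-output maps. $\Phi$ admits a *generalized kernel representation* if for all $f\in\Phi$ and all non-empty words $w$ of length $k$ there are functions $K^{f}_w:T^k\to\mathbb{R}^p$ and $G_w:T^k\to\mathbb{R}^{p\times m}$ such that: (1) all $K^f_w$, $G_w$ are analytic on $T^k$; (2) for all words $w,v$ and $q\in Q$, $K^f_{wqqv}(\dots,t,\hat t,\dots)=K^f_{wqv}(\dots,t+\hat t,\dots)$, and the same holds for $G$; (3) $K^f_{vqw}(\dots,0,\dots)=K^f_{vw}(\dots)$, with the time $0$ at the letter $q$, whenever $w\neq\epsilon$,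 and the same for $G$ whenever $v\ne\epsilon$ and $w\neq\epsilon$; (4) $f(u,(q_1,t_1)\cdots(q_k,t_k))=K^f_{q_1\cdots q_k}(t_1,\dots,t_k)+\sum_{i=1}^k\int_0^{t_i}G_{q_i\cdots q_k}(t_i-s,t_{i+1},\dots,t_k)\,u\big(s+\sum_{j<i}t_j\big)\,ds$ for all $u\in PC(T,\mathbb{R}^m)$ and all switching sequences. Write $f_{u,q_1\cdots q_k}(t_1,\dots,t_k)=f(u,(q_1,t_1)\cdots(q_k,t_k))$. The *Markov parameters* of $\Phi$ are the vectors of $\mathbb{R}^p$, for $f\in\Phi$, $q,q_0\in Q$, $1\le j\le m$, $w=q_1\cdots q_k\in Q^*$, $$S_{f,q}(w)=\tfrac{d}{dt_1}\cdots\tfrac{d}{dt_k}f_{0,q_1\cdots q_kq}(t_1,\dots,t_k,0)\big|_{t=0},$$ $$S_{q,q_0,j}(w)=\tfrac{d}{dt_0}\cdots\tfrac{d}{dt_k}f_{e_j,q_0q_1\cdots q_kq}(t_0,\dots,t_k,0)\big|_{t=0}-\tfrac{d}{dt_0}\cdots\tfrac{d}{dt_k}f_{0,q_0q_1\cdots q_kq}(t_0,\dots,t_k,0)\big|_{t=0},$$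 where the derivatives at $0$ are one-sided and $e_j$ is the constant input equal to the $j$-th unit vector; $S_{q,q_0,j}(w)$ is computed from any $f\in\Phi$ (if $\Phi$ admits a generalized kernel representation, it does not depend on which one). For $L,M\in\mathbb{N}$ the matrix $H_{\Phi,L,M}$ has rows indexed by $(v,(q,r))$ with $v\in Q^*$, $|v|\le L$, $q\in Q$, $1\le r\le p$, and columns indexed by $(w,j)$ with $w\in Q^*$, $|w|\le M$, $j\in J_\Phi=\Phi\sqcup(Q\times\{1,\dots,m\})$; its entry is $(S_{f,q}(wv))_r$ if $j=f\in\Phi$ and $(S_{q,q_0,z}(wv))_r$ if $j=(q_0,z)$. Its rank is the dimension of the span of its columns. A *linear switched system* (LSS) $\Sigma$ of dimension $n\ge 0$ consists of matrices $A_q\in\mathbb{R}^{n\times n}$, $B_q\in\mathbb{R}^{n\times m}$, $C_q\in\mathbb{R}^{p\times n}$, $q\in Q$. The state $x_\Sigma(x_0,u,w)$ is obtained from $x_0$ by successively following, for $i=1,\dots,k$ and during time $t_i$, the solution of $\dot x(s)=A_{q_i}x(s)+B_{q_i}u(s+\sum_{j<i}t_j)$; the output is $y_\Sigma(x_0,u,w)=C_{q_k}x_\Sigma(x_0,u,w)$.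 A *realization* $(\Sigma,\mu)$ is an LSS with a map $\mu:\Phi\to\mathbb{R}^n$. It is *semi-reachable* if the states $x_\Sigma(\mu(f),u,w)$ (all $f\in\Phi$, $u$, $w$) span $\mathbb{R}^n$, and *observable* if distinct states induce distinct maps $(u,w)\mapsto y_\Sigma(x,u,w)$. It is an *$N$-partial realization* of $\Phi$ if $S_{q,q_0,j}(q_1\cdots q_k)=C_qA_{q_k}\cdots A_{q_1}B_{q_0}e_j$ and $S_{f,q}(q_1\cdots q_k)=C_qA_{q_k}\cdots A_{q_1}\mu(f)$ for all $q,q_0\in Q$, $f\in\Phi$, $1\le j\le m$ and all words $q_1\cdots q_k$ of length $0\le k\le N$; it is a *minimal* one if no $N$-partial realization has smaller dimension. Realizations $(\Sigma,\mu)$, $(\Sigma',\mu')$ are *isomorphic* if there is a linear isomorphism $S$ of the state-spaces with $A'_qS=SA_q$, $B'_q=SB_q$, $C'_qS=C_q$ for all $q\in Q$, and $S\circ\mu=\mu'$. *Algorithm 1.* Let $n=\operatorname{rank}H_{\Phi,N,N+1}$, let $\mathbf{c}_{w,j}$ be the column of $H_{\Phi,N,N+1}$ with index $(w,j)$, and let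 $\varphi$ be any linear isomorphism from its column space onto $\mathbb{R}^n$. Return the realization $(\Sigma_N,\mu_N)$ of dimension $n$ determined by: the $j$-th column of $B_q$ is $\varphi(\mathbf{c}_{\epsilon,(q,j)})$; $C_q\varphi(\mathbf{c}_{w,j})$ is the vector of the $p$ entries of $\mathbf{c}_{w,j}$ in the rows $(\epsilon,(q,1)),\dots,(\epsilon,(q,p))$, for $|w|\le N+1$, $j\in J_\Phi$; $\varphi^{-1}A_q\varphi(\mathbf{c}_{w,j})=\mathbf{c}_{wq,j}$ for $|w|\le N$, $j\in J_\Phi$; $\mu_N(f)=\varphi(\mathbf{c}_{\epsilon,f})$ for $f\in\Phi$. Abort if the equations for $A_q$ have no solution. **Theorem 2 (Minimal partial realization).** Let $\Phi$ be a non-empty family of input-output maps that admits a generalized kernel representation, and suppose that for some integer $N>0$ $$\operatorname{rank}H_{\Phi,N,N}=\operatorname{rank}H_{\Phi,N+1,N}=\operatorname{rank}H_{\Phi,N,N+1}.$$ Then: 1. A minimal $(2N+1)$-partial realization of $\Phi$ exists; in fact, for every choice of the isomorphism $\varphi$, Algorithm 1 does not abort, its equations determine a unique realization $(\Sigma_N,\mu_N)$,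 and $(\Sigma_N,\mu_N)$ is a minimal $(2N+1)$-partial realization of $\Phi$. 2. Every minimal $(2N+1)$-partial realization of $\Phi$ is semi-reachable and observable, and its dimension is $\operatorname{rank}H_{\Phi,N,N}$. 3. All minimal $(2N+1)$-partial realizations of $\Phi$ are isomorphic. -/

import Mathlib

open scoped NNReal Topology Matrix

noncomputable section

namespace SwitchedSystem

/-- Piecewise-continuity of a map on the time axis `T = [0, ∞)`. At `s = 0` the condition on the
left-hand limit is void, because `𝓝[<] (0 : ℝ≥0) = ⊥`. -/
def IsPiecewiseContinuous {E : Type*} [TopologicalSpace E] (u : ℝ≥0 → E) : Prop :=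
  (∀ t : ℝ≥0, {s | s ≤ t ∧ ¬ ContinuousAt u s}.Finite) ∧
  ∀ s, ¬ ContinuousAt u s →
    (∃ l, Filter.Tendsto u (𝓝[<] s) (𝓝 l)) ∧ (∃ r, Filter.Tendsto u (𝓝[>] s) (𝓝 r))

/-- The space `PC(T, ℝ^m)` of continuous-valued inputs. -/
def PC (m : ℕ) : Type := {u : ℝ≥0 → (Fin m → ℝ) // IsPiecewiseContinuous u}

theorem isPiecewiseContinuous_const {E : Type*} [TopologicalSpace E] (c : E) :
    IsPiecewiseContinuous (fun _ : ℝ≥0 => c) :=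
  ⟨fun t => by simp [continuousAt_const], fun s h => absurd continuousAt_const h⟩

/-- The constant input with value `c`. -/
def PC.const {m : ℕ} (c : Fin m → ℝ) : PC m := ⟨fun _ => c, isPiecewiseContinuous_const c⟩

/-- The non-empty switching sequences `(q₁,t₁)⋯(q_k,t_k)`, i.e. `(Q × T)⁺`. -/
abbrev SwitchSeq (Q : Type*) : Type _ := {w : List (Q × ℝ≥0) // w ≠ []}

/-- Input-output maps `PC(T, ℝ^m) × (Q × T)⁺ → ℝ^p`. -/
abbrev IOMap (Q : Type*) (m p : ℕ) : Type _ := PC m → SwitchSeq Q → (Fin p → ℝ)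

/-- Total duration of a switching sequence. -/
def duration {Q : Type*} (w : List (Q × ℝ≥0)) : ℝ≥0 := (w.map Prod.snd).sum

/-- A linear switched system with modes `Q`, state-space `ℝ^n`, inputs in `ℝ^m` and outputs in
`ℝ^p`. -/
@[ext]
structure LSS (Q : Type*) (n m p : ℕ) where
  A : Q → Matrix (Fin n) (Fin n) ℝ
  B : Q → Matrix (Fin n) (Fin m) ℝ
  C : Q → Matrix (Fin p) (Fin n) ℝ

namespace LSS

variable {Q : Type*} {n m p : ℕ}

/-- `ξ` solves `ξ' = A_q ξ + B_q u(· + τ)` on `[0, ∞)`: it is continuous and satisfies the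
differential equation at every positive time at which the input is continuous. -/
def IsSolution (S : LSS Q n m p) (q : Q) (u : PC m) (τ : ℝ≥0) (ξ : ℝ → (Fin n → ℝ)) : Prop :=
  ContinuousOn ξ (Set.Ici 0) ∧
  ∀ s : ℝ≥0, 0 < s → ContinuousAt u.1 (s + τ) →
    HasDerivAt ξ (S.A q *ᵥ ξ s + S.B q *ᵥ u.1 (s + τ)) (s : ℝ)

/-- `S.StateAt u τ w x₀ x`: starting in `x₀` at the time `τ` and running through the switching
sequence `w` with the input `u`, the system ends in the state `x`. In each mode the solution of the
corresponding differential equation is followed for the prescribed time, starting from the state in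
which the previous mode ended. -/
def StateAt (S : LSS Q n m p) (u : PC m) :
    ℝ≥0 → List (Q × ℝ≥0) → (Fin n → ℝ) → (Fin n → ℝ) → Prop
  | _, [], x₀, x => x = x₀
  | τ, (q, t) :: w, x₀, x =>
      ∃ ξ : ℝ → (Fin n → ℝ), S.IsSolution q u τ ξ ∧ ξ 0 = x₀ ∧ S.StateAt u (τ + t) w (ξ t) x

/-- `x = x_Σ(x₀, u, w)`. -/
def IsState (S : LSS Q n m p) (x₀ : Fin n → ℝ) (u : PC m) (w : SwitchSeq Q)
    (x : Fin n → ℝ) : Prop :=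
  S.StateAt u 0 w.1 x₀ x

/-- `y = y_Σ(x₀, u, w) = C_{q_k} x_Σ(x₀, u, w)`, where `q_k` is the last mode of `w`. -/
def IsOutput (S : LSS Q n m p) (x₀ : Fin n → ℝ) (u : PC m) (w : SwitchSeq Q)
    (y : Fin p → ℝ) : Prop :=
  ∃ x, S.IsState x₀ u w x ∧ y = S.C (w.1.getLast w.2).1 *ᵥ x

/-- The set of states reachable from `X₀`. -/
def reach (S : LSS Q n m p) (X₀ : Set (Fin n → ℝ)) : Set (Fin n → ℝ) :=
  {x | ∃ x₀ ∈ X₀, ∃ u : PC m, ∃ w : SwitchSeq Q, S.IsState x₀ u w x}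

/-- Semi-reachability from `X₀`: the reachable set spans the state-space. -/
def IsSemiReachableFrom (S : LSS Q n m p) (X₀ : Set (Fin n → ℝ)) : Prop :=
  Submodule.span ℝ (S.reach X₀) = ⊤

/-- The states `x₁`, `x₂` induce the same input-output map (as graphs). -/
def Indistinguishable (S : LSS Q n m p) (x₁ x₂ : Fin n → ℝ) : Prop :=
  ∀ (u : PC m) (w : SwitchSeq Q) (y : Fin p → ℝ), S.IsOutput x₁ u w y ↔ S.IsOutput x₂ u w y

def IsObservable (S : LSS Q n m p) : Prop :=
  ∀ x₁ x₂, S.Indistinguishable x₁ x₂ → x₁ = x₂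

/-- `A_w = A_{q_k} ⋯ A_{q_1}` for `w = q_1 ⋯ q_k`. -/
def wordProd (S : LSS Q n m p) (w : List Q) : Matrix (Fin n) (Fin n) ℝ :=
  (w.map S.A).reverse.prod

end LSS

/-- A realization `(Σ, μ)` for the family `Φ`: a linear switched system of dimension `n` with an
assignment of states to the elements of `Φ`. -/
@[ext]
structure Realization {Q : Type*} {m p : ℕ} (Φ : Set (IOMap Q m p)) (n : ℕ) extends
    LSS Q n m p where
  μ : Φ → (Fin n → ℝ)

/-! ### Generalized kernel representations

A function `K_w : T^{|w|} → E` for every word `w` is written as one function of lists of pairs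
`(q₁,t₁)⋯(q_k,t_k)`. -/

section Kernel

variable {Q : Type*} {m p : ℕ}

/-- The function `(t₁,…,t_k) ↦ F((q₁,t₁)⋯(q_k,t_k))` is analytic on `T^k` for each non-empty word
`q₁⋯q_k`. -/
def AnalyticInTimes (F : List (Q × ℝ≥0) → ℝ) : Prop :=
  ∀ w : List Q, w ≠ [] →
    AnalyticOn ℝ
      (fun t : Fin w.length → ℝ => F (List.ofFn fun i => (w.get i, (t i).toNNReal)))
      {t | ∀ i, 0 ≤ t i}

/-- `∑ᵢ ∫₀^{tᵢ} G_{qᵢ⋯q_k}(tᵢ - s, tᵢ₊₁, …, t_k) u(s + t₁ + ⋯ + tᵢ₋₁) ds`. -/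
def forcedResponse (G : List (Q × ℝ≥0) → Matrix (Fin p) (Fin m) ℝ) (u : PC m)
    (w : List (Q × ℝ≥0)) : Fin p → ℝ :=
  ∑ i : Fin w.length, ∫ s in (0 : ℝ)..((w.get i).2 : ℝ),
    G (((w.get i).1, (w.get i).2 - s.toNNReal) :: w.drop (i + 1)) *ᵥ
      u.1 (s.toNNReal + duration (w.take i))

def HasGeneralizedKernelRepresentation (Φ : Set (IOMap Q m p)) : Prop :=
  ∃ (K : Φ → List (Q × ℝ≥0) → (Fin p → ℝ))
    (G : List (Q × ℝ≥0) → Matrix (Fin p) (Fin m) ℝ),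
    ((∀ f i, AnalyticInTimes fun w => K f w i) ∧ (∀ i j, AnalyticInTimes fun w => G w i j)) ∧
    ((∀ f w v q t t', K f (w ++ (q, t) :: (q, t') :: v) = K f (w ++ (q, t + t') :: v)) ∧
      (∀ w v q t t', G (w ++ (q, t) :: (q, t') :: v) = G (w ++ (q, t + t') :: v))) ∧
    ((∀ f v w q, w ≠ [] → K f (v ++ (q, 0) :: w) = K f (v ++ w)) ∧
      (∀ v w q, v ≠ [] → w ≠ [] → G (v ++ (q, 0) :: w) = G (v ++ w))) ∧
    ∀ (f : Φ) (u : PC m) (w : SwitchSeq Q), f.1 u w = K f w.1 + forcedResponse G u w.1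

end Kernel

/-! ### Markov parameters and Hankel matrices -/

section Hankel

variable {Q : Type*} {m p : ℕ}

/-- The mixed derivative `d/dt₁ ⋯ d/dt_k F((q₁,t₁)⋯(q_k,t_k))` at `t₁ = ⋯ = t_k = 0`, with
one-sided derivatives since the times range over `[0, ∞)`. -/
def mixedDeriv {E : Type*} [NormedAddCommGroup E] [NormedSpace ℝ E] :
    List Q → (List (Q × ℝ≥0) → E) → E
  | [], F => F []
  | q :: w, F =>
      derivWithin (fun t : ℝ => mixedDeriv w fun s => F ((q, t.toNNReal) :: s)) (Set.Ici 0) 0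

/-- The mixed derivative in `t₁, …, t_k` at zero of `f_{u, q₁⋯q_k q}(t₁, …, t_k, 0)`, for
`w = q₁⋯q_k`. -/
def ioDeriv (f : IOMap Q m p) (u : PC m) (w : List Q) (q : Q) : Fin p → ℝ :=
  mixedDeriv w fun s => f u ⟨s ++ [(q, 0)], by simp⟩

/-- The Markov parameter `S_{f,q}(w)`. -/
def markovState (f : IOMap Q m p) (q : Q) (w : List Q) : Fin p → ℝ :=
  ioDeriv f (PC.const 0) w q

/-- The Markov parameter `S_{q,q₀,j}(w)`, computed from the element `f` of the family. For a family
that admits a generalized kernel representation the value is the same for all elements `f`. -/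
def markovInput (f : IOMap Q m p) (q q₀ : Q) (j : Fin m) (w : List Q) : Fin p → ℝ :=
  ioDeriv f (PC.const (Pi.single j 1)) (q₀ :: w) q - ioDeriv f (PC.const 0) (q₀ :: w) q

/-- The index set `J_Φ = Φ ∪ (Q × {1,…,m})`. -/
abbrev ColIdx (Φ : Set (IOMap Q m p)) : Type _ := Φ ⊕ (Q × Fin m)

variable (Φ : Set (IOMap Q m p)) (f₀ : Φ)

/-- The Hankel matrix of `Φ`. The set `{1,…,p|Q|}` of row labels is replaced by `Q × {1,…,p}`, the
row `pK + r + 1` being labelled `(σ_{K+1}, r + 1)`. The Markov parameters `S_{q,q₀,j}` are computed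
from the element `f₀` of `Φ`. -/
def hankel : Matrix (List Q × (Q × Fin p)) (List Q × ColIdx Φ) ℝ :=
  fun vi wj =>
    match wj.2 with
    | Sum.inl f => markovState f.1 vi.2.1 (wj.1 ++ vi.1) vi.2.2
    | Sum.inr (q₀, j) => markovInput f₀.1 vi.2.1 q₀ j (wj.1 ++ vi.1) vi.2.2

/-- The words of length at most `L`. -/
abbrev Words (Q : Type*) (L : ℕ) : Type _ := {w : List Q // w.length ≤ L}

/-- The sub-matrix `H_{Φ,L,M}` of the Hankel matrix. -/
def subHankel (L M : ℕ) : Matrix (Words Q L × (Q × Fin p)) (Words Q M × ColIdx Φ) ℝ :=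
  fun vi wj => hankel Φ f₀ (vi.1.1, vi.2) (wj.1.1, wj.2)

/-- The column space of `H_{Φ,L,M}`. -/
def colSpace (L M : ℕ) : Submodule ℝ (Words Q L × (Q × Fin p) → ℝ) :=
  Submodule.span ℝ (Set.range (subHankel Φ f₀ L M).col)

/-- The rank of `H_{Φ,L,M}`, i.e. the dimension of its column space (which is finite when `Q` is,
because then there are finitely many rows). -/
def hankelRank (L M : ℕ) : ℕ := Module.finrank ℝ (colSpace Φ f₀ L M)

/-- The column of `H_{Φ,L,M}` with index `(w,j)`, as an element of the column space. -/
def colVec (L M : ℕ) (w : Words Q M) (j : ColIdx Φ) : colSpace Φ f₀ L M :=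
  ⟨(subHankel Φ f₀ L M).col (w, j), Submodule.subset_span ⟨(w, j), rfl⟩⟩

/-- The empty word. -/
def emptyWord (L : ℕ) : Words Q L := ⟨[], by simp⟩

/-- `w` as a word of length at most `L + 1`. -/
def Words.lift {L : ℕ} (w : Words Q L) : Words Q (L + 1) := ⟨w.1, w.2.trans L.le_succ⟩

/-- The word `wq`. -/
def Words.snoc {L : ℕ} (w : Words Q L) (q : Q) : Words Q (L + 1) :=
  ⟨w.1 ++ [q], by simpa using w.2⟩

end Hankel

/-! ### Partial realizations -/

namespace Realization

variable {Q : Type*} {m p : ℕ} {Φ : Set (IOMap Q m p)} {n : ℕ}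

def IsSemiReachable (R : Realization Φ n) : Prop :=
  R.toLSS.IsSemiReachableFrom (Set.range R.μ)

def IsObservable (R : Realization Φ n) : Prop := R.toLSS.IsObservable

/-- `R` reproduces the Markov parameters of `Φ` indexed by words of length at most `N`. -/
def IsPartialRealization (R : Realization Φ n) (f₀ : Φ) (N : ℕ) : Prop :=
  ∀ w : List Q, w.length ≤ N → ∀ q : Q,
    (∀ (q₀ : Q) (j : Fin m),
      markovInput f₀.1 q q₀ j w = (R.C q * R.wordProd w * R.B q₀) *ᵥ Pi.single j 1) ∧
    ∀ f : Φ, markovState f.1 q w = (R.C q * R.wordProd w) *ᵥ R.μ f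

def IsMinimalPartialRealization (R : Realization Φ n) (f₀ : Φ) (N : ℕ) : Prop :=
  R.IsPartialRealization f₀ N ∧
  ∀ (n' : ℕ) (R' : Realization Φ n'), R'.IsPartialRealization f₀ N → n ≤ n'

/-- The linear map `S` is a morphism of realizations from `R₁` to `R₂`. -/
def IsMorphism {n₁ n₂ : ℕ} (R₁ : Realization Φ n₁) (R₂ : Realization Φ n₂)
    (S : (Fin n₁ → ℝ) →ₗ[ℝ] (Fin n₂ → ℝ)) : Prop :=
  (∀ q x, R₂.A q *ᵥ S x = S (R₁.A q *ᵥ x)) ∧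
  (∀ q u, R₂.B q *ᵥ u = S (R₁.B q *ᵥ u)) ∧
  (∀ q x, R₂.C q *ᵥ S x = R₁.C q *ᵥ x) ∧
  ∀ f, S (R₁.μ f) = R₂.μ f

def Isomorphic {n₁ n₂ : ℕ} (R₁ : Realization Φ n₁) (R₂ : Realization Φ n₂) : Prop :=
  ∃ S : (Fin n₁ → ℝ) ≃ₗ[ℝ] (Fin n₂ → ℝ), IsMorphism R₁ R₂ S.toLinearMap

/-- `R` is a result of the column-space algorithm applied to `H_{Φ,N,N+1}` with the isomorphism `φ`
from the column space to `ℝ^n`: it satisfies the equations which define the matrices `B_q`, `C_q`,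
`A_q` and the map `μ`. -/
def IsAlgorithmOutput (R : Realization Φ n) (f₀ : Φ) (N : ℕ)
    (φ : colSpace Φ f₀ N (N + 1) ≃ₗ[ℝ] (Fin n → ℝ)) : Prop :=
  (∀ q j, (R.B q).col j = φ (colVec Φ f₀ N (N + 1) (emptyWord (N + 1)) (Sum.inr (q, j)))) ∧
  (∀ q w j, R.C q *ᵥ φ (colVec Φ f₀ N (N + 1) w j) =
    fun r => subHankel Φ f₀ N (N + 1) (emptyWord N, (q, r)) (w, j)) ∧
  (∀ q (w : Words Q N) j,
    φ.symm (R.A q *ᵥ φ (colVec Φ f₀ N (N + 1) w.lift j)) =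
      colVec Φ f₀ N (N + 1) (w.snoc q) j) ∧
  ∀ f : Φ, R.μ f = φ (colVec Φ f₀ N (N + 1) (emptyWord (N + 1)) (Sum.inl f))

end Realization

end SwitchedSystem

end

open scoped NNReal Topology Matrix

/-! The argument is Ho–Kalman realization theory with words in place of powers. A realization
matching the Markov parameters up to length `K` factors the Hankel matrix for `M + L ≤ K`: `obsMap
L` (all `C_q A_v`, `|v| ≤ L`) carries the vectors `A_w b`, `|w| ≤ M`, to the columns
(`IsPartialRealization.map_obsMap_genSpan`). So every dimension is at least the rank, and equality
forces `A_w b` to span and `obsMap L` to be injective.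

For existence, the column space itself is the state space. Rank invariance under extra rows makes
the shift of column `w` to column `wq` well defined and linear (`exists_columnShift`); invariance
under extra columns makes the columns with `|w| ≤ N` span, which fixes `A_q`
(`existsUnique_isAlgorithmOutput`). A word of length at most `2N + 1` splits into a column word of
length at most `N + 1` and a row word of length at most `N`, so all required parameters are
reproduced. For uniqueness, two realizations of dimension equal to the rank have injective `obsMap
N` with the same image, and comparing them there gives the isomorphism
(`isomorphic_of_eq_hankelRank`).

The algebraic rank conditions imply the dynamical notions by differentiating trajectories at time
zero: the span of reachable states contains every `A_w b`, and the states with zero output under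
zero input form an `A_q`-invariant subspace killed by every `C_q`. -/

namespace SwitchedSystem

/-! ### Words and products of state matrices -/

section Words

variable {Q : Type*} {m p n : ℕ}

@[simp]
theorem LSS.wordProd_nil (S : LSS Q n m p) : S.wordProd [] = 1 := rfl

theorem LSS.wordProd_append (S : LSS Q n m p) (w v : List Q) :
    S.wordProd (w ++ v) = S.wordProd v * S.wordProd w := by
  simp [LSS.wordProd]

theorem LSS.wordProd_cons (S : LSS Q n m p) (q : Q) (w : List Q) :
    S.wordProd (q :: w) = S.wordProd w * S.A q := by
  simp [LSS.wordProd]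

theorem LSS.wordProd_concat (S : LSS Q n m p) (w : List Q) (q : Q) :
    S.wordProd (w ++ [q]) = S.A q * S.wordProd w := by
  simp [LSS.wordProd]

instance Words.instFinite [Finite Q] (L : ℕ) : Finite (Words Q L) :=
  (List.finite_length_le Q L).to_subtype

/-- The word `qv`. -/
def Words.cons {L : ℕ} (q : Q) (v : Words Q L) : Words Q (L + 1) :=
  ⟨q :: v.1, by simpa using v.2⟩

end Words

/-! ### Shift structure of the Hankel matrix -/

section HankelShift

variable {Q : Type*} {m p : ℕ} (Φ : Set (IOMap Q m p)) (f₀ : Φ)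

/-- The Hankel property: letters may be moved freely between the row word and the column word. -/
theorem hankel_eq_of_append_eq {v v' w w' : List Q} (h : w ++ v = w' ++ v') (i : Q × Fin p)
    (j : ColIdx Φ) : hankel Φ f₀ (v, i) (w, j) = hankel Φ f₀ (v', i) (w', j) := by
  rcases j with f | ⟨q₀, j⟩ <;> simp [hankel, h]

/-- The restriction of a vector indexed by the rows of `H_{Φ,L+1,M}` to the rows of `H_{Φ,L,M}`. -/
def restrictRows (Q : Type*) (p L : ℕ) :
    (Words Q (L + 1) × (Q × Fin p) → ℝ) →ₗ[ℝ] (Words Q L × (Q × Fin p) → ℝ) :=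
  LinearMap.funLeft ℝ ℝ fun i => (i.1.lift, i.2)

/-- The map which sends a vector indexed by the rows of `H_{Φ,L+1,M}` to the vector of its entries
in the rows `qv`. -/
def shiftRows (p L : ℕ) (q : Q) :
    (Words Q (L + 1) × (Q × Fin p) → ℝ) →ₗ[ℝ] (Words Q L × (Q × Fin p) → ℝ) :=
  LinearMap.funLeft ℝ ℝ fun i => (i.1.cons q, i.2)

theorem shiftRows_col (L M : ℕ) (q : Q) (w : Words Q M) (j : ColIdx Φ) :
    shiftRows p L q ((subHankel Φ f₀ (L + 1) M).col (w, j)) =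
      (subHankel Φ f₀ L (M + 1)).col (w.snoc q, j) := by
  ext i
  exact hankel_eq_of_append_eq Φ f₀ (by simp [Words.cons, Words.snoc]) i.2 j

theorem map_restrictRows_colSpace (L M : ℕ) :
    (colSpace Φ f₀ (L + 1) M).map (restrictRows Q p L) = colSpace Φ f₀ L M := by
  rw [colSpace, colSpace, Submodule.map_span, ← Set.range_comp]
  rfl

theorem colSpace_le_succ (L M : ℕ) : colSpace Φ f₀ L M ≤ colSpace Φ f₀ L (M + 1) := by
  refine Submodule.span_mono ?_
  rintro _ ⟨⟨w, j⟩, rfl⟩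
  exact ⟨(w.lift, j), rfl⟩

variable [Finite Q]

theorem colSpace_eq_succ {L M : ℕ} (h : hankelRank Φ f₀ L M = hankelRank Φ f₀ L (M + 1)) :
    colSpace Φ f₀ L M = colSpace Φ f₀ L (M + 1) :=
  Submodule.eq_of_le_of_finrank_eq (colSpace_le_succ Φ f₀ L M) h

theorem span_colVec_lift {L M : ℕ} (h : hankelRank Φ f₀ L M = hankelRank Φ f₀ L (M + 1)) :
    Submodule.span ℝ (Set.range fun x : Words Q M × ColIdx Φ =>
      colVec Φ f₀ L (M + 1) x.1.lift x.2) = ⊤ := by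
  refine Submodule.map_injective_of_injective (colSpace Φ f₀ L (M + 1)).injective_subtype ?_
  rw [Submodule.map_span, ← Set.range_comp, Submodule.map_subtype_top]
  exact colSpace_eq_succ Φ f₀ h

/-- If additional rows do not increase the rank of the Hankel matrix, the columns `(wq,j)` depend
linearly on the columns `(w,j)`. -/
theorem exists_columnShift {L M : ℕ} (h : hankelRank Φ f₀ L M = hankelRank Φ f₀ (L + 1) M)
    (q : Q) : ∃ T : (Words Q L × (Q × Fin p) → ℝ) →ₗ[ℝ] (Words Q L × (Q × Fin p) → ℝ),
      ∀ (w : Words Q M) (j : ColIdx Φ), T ((subHankel Φ f₀ L M).col (w, j)) =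
        (subHankel Φ f₀ L (M + 1)).col (w.snoc q, j) := by
  set X := colSpace Φ f₀ (L + 1) M
  -- Dropping the longest rows maps `X` onto the smaller column space, which has the same dimension.
  -- The discarded entries can thus be recovered linearly, and the shift reads them off.
  have hker : LinearMap.ker ((restrictRows Q p L).domRestrict X) = ⊥ := by
    rw [← Submodule.finrank_eq_zero (R := ℝ)]
    have h₁ := ((restrictRows Q p L).domRestrict X).finrank_range_add_finrank_ker
    rw [LinearMap.range_domRestrict, map_restrictRows_colSpace] at h₁
    change hankelRank Φ f₀ L M + _ = hankelRank Φ f₀ (L + 1) M at h₁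
    omega
  obtain ⟨ψ, hψ⟩ := LinearMap.exists_leftInverse_of_injective _ hker
  refine ⟨shiftRows p L q ∘ₗ X.subtype ∘ₗ ψ, fun w j => ?_⟩
  have := LinearMap.congr_fun hψ (colVec Φ f₀ (L + 1) M w j)
  have h₂ : ψ ((subHankel Φ f₀ L M).col (w, j)) = colVec Φ f₀ (L + 1) M w j := this
  simp only [LinearMap.comp_apply, h₂]
  exact shiftRows_col Φ f₀ L M q w j

end HankelShift

/-! ### Factorization of the Hankel matrix, the algorithm, and uniqueness -/

namespace Realization

variable {Q : Type*} {m p n : ℕ} {Φ : Set (IOMap Q m p)} {f₀ : Φ}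

/-- The vectors `μ(f)` and `B_q e_j`, which generate the reachable space under the `A_q`. -/
def gen (R : Realization Φ n) : ColIdx Φ → (Fin n → ℝ)
  | Sum.inl f => R.μ f
  | Sum.inr (q, j) => (R.B q).col j

/-- Since `A_{wv} = A_v A_w`, each Markov equation may be read at every splitting of its word; the
converse needs only the splitting with `v` empty. -/
theorem isPartialRealization_iff (R : Realization Φ n) (K : ℕ) :
    R.IsPartialRealization f₀ K ↔ ∀ (v w : List Q), w.length + v.length ≤ K →
      ∀ (q : Q) (r : Fin p) (j : ColIdx Φ), hankel Φ f₀ (v, (q, r)) (w, j) =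
        (R.C q *ᵥ (R.wordProd v *ᵥ (R.wordProd w *ᵥ R.gen j))) r := by
  constructor
  · intro h v w hvw q r j
    obtain ⟨h₁, h₂⟩ := h (w ++ v) (by simpa using hvw) q
    rcases j with f | ⟨q₀, j⟩
    · simp [hankel, h₂, gen, LSS.wordProd_append]
    · simp only [hankel, h₁, gen, LSS.wordProd_append, ← Matrix.mulVec_single_one,
        Matrix.mulVec_mulVec, Matrix.mul_assoc]
  · intro h w hw q
    refine ⟨fun q₀ j => ?_, fun f => ?_⟩
    · ext r
      have := h [] w (by simpa using hw) q r (Sum.inr (q₀, j))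
      simpa only [hankel, gen, List.append_nil, LSS.wordProd_nil, Matrix.one_mul,
        ← Matrix.mulVec_single_one, Matrix.mulVec_mulVec, Matrix.mul_assoc] using this
    · ext r
      have := h [] w (by simpa using hw) q r (Sum.inl f)
      simpa [hankel, gen, ← Matrix.mulVec_mulVec] using this

/-- The map `x ↦ (C_q A_v x)` over the words `v` of length at most `L`. -/
noncomputable def obsMap (R : Realization Φ n) (L : ℕ) :
    (Fin n → ℝ) →ₗ[ℝ] (Words Q L × (Q × Fin p) → ℝ) :=
  LinearMap.pi fun i => LinearMap.proj i.2.2 ∘ₗ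
    (R.C i.2.1).mulVecLin ∘ₗ (R.wordProd i.1.1).mulVecLin

theorem obsMap_apply (R : Realization Φ n) (L : ℕ) (x : Fin n → ℝ)
    (i : Words Q L × (Q × Fin p)) :
    R.obsMap L x i = (R.C i.2.1 *ᵥ (R.wordProd i.1.1 *ᵥ x)) i.2.2 :=
  rfl

/-- The span of the vectors `A_w b` over the words `w` of length at most `M` and the generators
`b`. -/
def genSpan (R : Realization Φ n) (M : ℕ) : Submodule ℝ (Fin n → ℝ) :=
  Submodule.span ℝ (Set.range fun x : Words Q M × ColIdx Φ => R.wordProd x.1.1 *ᵥ R.gen x.2)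

theorem IsPartialRealization.obsMap_gen {R : Realization Φ n} {K : ℕ}
    (h : R.IsPartialRealization f₀ K) {L M : ℕ} (hLM : M + L ≤ K) (w : Words Q M)
    (j : ColIdx Φ) :
    R.obsMap L (R.wordProd w.1 *ᵥ R.gen j) = (subHankel Φ f₀ L M).col (w, j) := by
  ext ⟨v, q, r⟩
  exact ((R.isPartialRealization_iff K).1 h v.1 w.1
    ((add_le_add w.2 v.2).trans hLM) q r j).symm

theorem IsPartialRealization.map_obsMap_genSpan {R : Realization Φ n} {K : ℕ}
    (h : R.IsPartialRealization f₀ K) {L M : ℕ} (hLM : M + L ≤ K) :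
    (R.genSpan M).map (R.obsMap L) = colSpace Φ f₀ L M := by
  rw [genSpan, colSpace, Submodule.map_span, ← Set.range_comp]
  congr 2
  ext1 x
  exact h.obsMap_gen hLM x.1 x.2

theorem IsPartialRealization.hankelRank_le {R : Realization Φ n} {K : ℕ}
    (h : R.IsPartialRealization f₀ K) {L M : ℕ} (hLM : M + L ≤ K) :
    hankelRank Φ f₀ L M ≤ n := by
  rw [hankelRank, ← h.map_obsMap_genSpan hLM]
  exact (Submodule.finrank_map_le _ _).trans ((Submodule.finrank_le _).trans (by simp))

theorem IsPartialRealization.genSpan_eq_top {R : Realization Φ n} {K : ℕ}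
    (h : R.IsPartialRealization f₀ K) {L M : ℕ} (hLM : M + L ≤ K)
    (hn : n = hankelRank Φ f₀ L M) : R.genSpan M = ⊤ := by
  refine Submodule.eq_top_of_finrank_eq (le_antisymm (Submodule.finrank_le _) ?_)
  have := Submodule.finrank_map_le (R.obsMap L) (R.genSpan M)
  rw [h.map_obsMap_genSpan hLM] at this
  simpa [hn, hankelRank] using this

theorem IsPartialRealization.ker_obsMap_eq_bot {R : Realization Φ n} {K : ℕ}
    (h : R.IsPartialRealization f₀ K) {L M : ℕ} (hLM : M + L ≤ K)
    (hn : n = hankelRank Φ f₀ L M) : LinearMap.ker (R.obsMap L) = ⊥ := by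
  rw [← Submodule.finrank_eq_zero (R := ℝ)]
  have h₁ := (R.obsMap L).finrank_range_add_finrank_ker
  rw [← Submodule.map_top, ← h.genSpan_eq_top hLM hn, h.map_obsMap_genSpan hLM,
    Module.finrank_fin_fun] at h₁
  change hankelRank Φ f₀ L M + _ = n at h₁
  omega

/-- Appending a letter to `w` is one application of the equation for `A_q`, which is available for
`|w| ≤ N`; hence the bound `N + 1` here. -/
theorem IsAlgorithmOutput.wordProd_gen {R : Realization Φ n} {N : ℕ}
    {φ : colSpace Φ f₀ N (N + 1) ≃ₗ[ℝ] (Fin n → ℝ)} (h : R.IsAlgorithmOutput f₀ N φ)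
    (w : Words Q (N + 1)) (j : ColIdx Φ) :
    R.wordProd w.1 *ᵥ R.gen j = φ (colVec Φ f₀ N (N + 1) w j) := by
  obtain ⟨w, hw⟩ := w
  induction w using List.reverseRecOn with
  | nil =>
    rcases j with f | ⟨q, j⟩
    · simpa [gen, emptyWord] using h.2.2.2 f
    · simpa [gen, emptyWord] using h.1 q j
  | append_singleton w q ih =>
    have hw' : w.length ≤ N := by simpa using hw
    have := h.2.2.1 q ⟨w, hw'⟩ j
    rw [φ.symm_apply_eq] at this
    rw [LSS.wordProd_concat, ← Matrix.mulVec_mulVec, ih (hw'.trans N.le_succ)]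
    exact this

/-- Induction on `v`, moving its first letter to the end of the column word. The equation for `A_q`
covers only `|w| ≤ N`, so the claim is proved as an identity of linear maps, checked on those
columns because they span. -/
theorem IsAlgorithmOutput.obsMap_apply [Finite Q] {R : Realization Φ n} {N : ℕ}
    {φ : colSpace Φ f₀ N (N + 1) ≃ₗ[ℝ] (Fin n → ℝ)} (h : R.IsAlgorithmOutput f₀ N φ)
    (hcol : hankelRank Φ f₀ N N = hankelRank Φ f₀ N (N + 1)) (v : List Q) (hv : v.length ≤ N)
    (q : Q) (w : Words Q (N + 1)) (j : ColIdx Φ) :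
    R.C q *ᵥ (R.wordProd v *ᵥ φ (colVec Φ f₀ N (N + 1) w j)) =
      fun r => subHankel Φ f₀ N (N + 1) (⟨v, hv⟩, (q, r)) (w, j) := by
  suffices H : ∀ r, LinearMap.proj r ∘ₗ (R.C q).mulVecLin ∘ₗ (R.wordProd v).mulVecLin ∘ₗ
      φ.toLinearMap = LinearMap.proj (⟨v, hv⟩, (q, r)) ∘ₗ (colSpace Φ f₀ N (N + 1)).subtype by
    ext r
    exact LinearMap.congr_fun (H r) (colVec Φ f₀ N (N + 1) w j)
  induction v with
  | nil =>
    intro r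
    refine LinearMap.ext_on (span_colVec_lift Φ f₀ hcol) ?_
    rintro _ ⟨⟨w, j⟩, rfl⟩
    simp only [LinearMap.comp_apply, LSS.wordProd_nil, Matrix.mulVecLin_one, LinearMap.id_apply]
    exact congrFun (h.2.1 q w.lift j) r
  | cons q' v ih =>
    intro r
    refine LinearMap.ext_on (span_colVec_lift Φ f₀ hcol) ?_
    rintro _ ⟨⟨w, j⟩, rfl⟩
    have hA := h.2.2.1 q' w j
    rw [φ.symm_apply_eq] at hA
    have := LinearMap.congr_fun (ih (by simp at hv; omega) r)
      (colVec Φ f₀ N (N + 1) (w.snoc q') j)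
    simp only [LinearMap.comp_apply, LinearEquiv.coe_coe, Matrix.mulVecLin_apply] at this ⊢
    rw [LSS.wordProd_cons, ← Matrix.mulVec_mulVec, hA, this]
    exact hankel_eq_of_append_eq Φ f₀ (by simp [Words.lift, Words.snoc]) (q, r) j

theorem IsAlgorithmOutput.isPartialRealization [Finite Q] {R : Realization Φ n} {N : ℕ}
    {φ : colSpace Φ f₀ N (N + 1) ≃ₗ[ℝ] (Fin n → ℝ)} (h : R.IsAlgorithmOutput f₀ N φ)
    (hcol : hankelRank Φ f₀ N N = hankelRank Φ f₀ N (N + 1)) :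
    R.IsPartialRealization f₀ (2 * N + 1) := by
  rw [isPartialRealization_iff]
  intro v w hvw q r j
  -- The given splitting may have either part too long, so the word is cut again after `N + 1`
  -- letters.
  have happ : w ++ v = (w ++ v).take (N + 1) ++ (w ++ v).drop (N + 1) :=
    (List.take_append_drop _ _).symm
  have hw' : ((w ++ v).take (N + 1)).length ≤ N + 1 := by simp
  have hv' : ((w ++ v).drop (N + 1)).length ≤ N := by simp; omega
  have key := congrFun (h.obsMap_apply hcol _ hv' q ⟨_, hw'⟩ j) r
  rw [← h.wordProd_gen ⟨_, hw'⟩ j, Matrix.mulVec_mulVec _ (R.wordProd _) (R.wordProd _),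
    ← LSS.wordProd_append, ← happ] at key
  rw [Matrix.mulVec_mulVec _ (R.wordProd v), ← LSS.wordProd_append, key]
  exact hankel_eq_of_append_eq Φ f₀ happ (q, r) j

theorem existsUnique_isAlgorithmOutput [Finite Q] {N : ℕ}
    (hrow : hankelRank Φ f₀ N N = hankelRank Φ f₀ (N + 1) N)
    (hcol : hankelRank Φ f₀ N N = hankelRank Φ f₀ N (N + 1))
    (φ : colSpace Φ f₀ N (N + 1) ≃ₗ[ℝ] (Fin n → ℝ)) :
    ∃! R : Realization Φ n, R.IsAlgorithmOutput f₀ N φ := by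
  have hspan : Submodule.span ℝ (Set.range fun x : Words Q N × ColIdx Φ =>
      φ (colVec Φ f₀ N (N + 1) x.1.lift x.2)) = ⊤ := by
    have := congrArg (Submodule.map φ.toLinearMap) (span_colVec_lift Φ f₀ hcol)
    rw [Submodule.map_span, ← Set.range_comp, Submodule.map_top, LinearEquiv.range] at this
    exact this
  choose T hT using exists_columnShift Φ f₀ hrow
  -- `T q` takes values in the ambient space; `π` returns them to the column space. Its choice off
  -- that space is irrelevant, as the shifted columns already lie in it.
  obtain ⟨π, hπ⟩ := LinearMap.exists_leftInverse_of_injective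
    (colSpace Φ f₀ N (N + 1)).subtype (Submodule.ker_subtype _)
  refine ⟨{ A := fun q => LinearMap.toMatrix' (φ.toLinearMap ∘ₗ π ∘ₗ T q ∘ₗ
              (colSpace Φ f₀ N (N + 1)).subtype ∘ₗ φ.symm.toLinearMap)
            B := fun q => (Matrix.of fun j =>
              φ (colVec Φ f₀ N (N + 1) (emptyWord (N + 1)) (Sum.inr (q, j))))ᵀ
            C := fun q => LinearMap.toMatrix' ((LinearMap.funLeft ℝ ℝ fun r =>
              (emptyWord N, (q, r))) ∘ₗ (colSpace Φ f₀ N (N + 1)).subtype ∘ₗ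
                φ.symm.toLinearMap)
            μ := fun f => φ (colVec Φ f₀ N (N + 1) (emptyWord (N + 1)) (Sum.inl f)) },
    ⟨fun q j => rfl, fun q w j => ?_, fun q w j => ?_, fun f => rfl⟩, fun R hR => ?_⟩
  · rw [LinearMap.toMatrix'_mulVec]
    simp only [LinearMap.comp_apply, LinearEquiv.coe_coe, LinearEquiv.symm_apply_apply]
    rfl
  · rw [LinearMap.toMatrix'_mulVec]
    simp only [LinearMap.comp_apply, LinearEquiv.coe_coe, LinearEquiv.symm_apply_apply]
    refine Eq.trans (congrArg π (hT q w j)) ?_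
    exact LinearMap.congr_fun hπ (colVec Φ f₀ N (N + 1) (w.snoc q) j)
  · obtain ⟨hB, hC, hA, hμ⟩ := hR
    apply Realization.ext
    · funext q
      apply Matrix.toLin'.injective
      rw [Matrix.toLin'_toMatrix']
      refine LinearMap.ext_on hspan ?_
      rintro _ ⟨⟨w, j⟩, rfl⟩
      have := hA q w j
      rw [φ.symm_apply_eq] at this
      simp only [LinearMap.comp_apply, LinearEquiv.coe_coe, LinearEquiv.symm_apply_apply,
        Matrix.toLin'_apply, this]
      congr 1
      refine Eq.symm (Eq.trans (congrArg π (hT q w j)) ?_)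
      exact LinearMap.congr_fun hπ (colVec Φ f₀ N (N + 1) (w.snoc q) j)
    · funext q
      ext i j
      exact congrFun (hB q j) i
    · funext q
      apply Matrix.toLin'.injective
      rw [Matrix.toLin'_toMatrix']
      refine LinearMap.ext_on hspan ?_
      rintro _ ⟨⟨w, j⟩, rfl⟩
      simp only [LinearMap.comp_apply, LinearEquiv.coe_coe, LinearEquiv.symm_apply_apply,
        Matrix.toLin'_apply, hC q w.lift j]
      rfl
    · funext f
      exact hμ f

theorem isomorphic_of_eq_hankelRank {n₁ n₂ N : ℕ} {R₁ : Realization Φ n₁}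
    {R₂ : Realization Φ n₂} (h₁ : R₁.IsPartialRealization f₀ (2 * N + 1))
    (h₂ : R₂.IsPartialRealization f₀ (2 * N + 1)) (hn₁ : n₁ = hankelRank Φ f₀ N N)
    (hn₂ : n₂ = hankelRank Φ f₀ N N) : R₁.Isomorphic R₂ := by
  have hspan₁ := h₁.genSpan_eq_top (L := N) (M := N) (by omega) hn₁
  have hspan₂ := h₂.genSpan_eq_top (L := N) (M := N) (by omega) hn₂
  have hker₁ := h₁.ker_obsMap_eq_bot (L := N) (M := N) (by omega) hn₁
  have hker₂ := h₂.ker_obsMap_eq_bot (L := N) (M := N) (by omega) hn₂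
  have hr₁ : LinearMap.range (R₁.obsMap N) = colSpace Φ f₀ N N := by
    rw [← Submodule.map_top, ← hspan₁, h₁.map_obsMap_genSpan (by omega)]
  have hr₂ : LinearMap.range (R₂.obsMap N) = colSpace Φ f₀ N N := by
    rw [← Submodule.map_top, ← hspan₂, h₂.map_obsMap_genSpan (by omega)]
  let e₁ := LinearEquiv.ofInjective (R₁.obsMap N) (LinearMap.ker_eq_bot.1 hker₁)
  let e₂ := LinearEquiv.ofInjective (R₂.obsMap N) (LinearMap.ker_eq_bot.1 hker₂)
  -- `S` is `O₂⁻¹ O₁`, where `Oᵢ` is `Rᵢ.obsMap N`.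
  let S := (e₁.trans (LinearEquiv.ofEq _ _ (hr₁.trans hr₂.symm))).trans e₂.symm
  have hS : ∀ x, R₂.obsMap N (S x) = R₁.obsMap N x := fun x =>
    congrArg Subtype.val (e₂.apply_symm_apply (LinearEquiv.ofEq _ _ (hr₁.trans hr₂.symm) (e₁ x)))
  -- The length `N + 1`, needed to intertwine `A_q` on the spanning vectors with `|w| ≤ N`, uses the
  -- full order `(N + 1) + N = 2N + 1`.
  have hgen : ∀ (w : Words Q (N + 1)) j,
      S (R₁.wordProd w.1 *ᵥ R₁.gen j) = R₂.wordProd w.1 *ᵥ R₂.gen j := fun w j =>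
    LinearMap.ker_eq_bot.1 hker₂ <| by
      rw [hS, h₁.obsMap_gen (by omega), h₂.obsMap_gen (by omega)]
  have hgen₀ : ∀ j, S (R₁.gen j) = R₂.gen j := fun j => by
    simpa [emptyWord] using hgen (emptyWord _) j
  refine ⟨S, fun q x => ?_, fun q u => ?_, fun q x => ?_, fun f => hgen₀ (Sum.inl f)⟩
  · have : (R₂.A q).mulVecLin ∘ₗ S.toLinearMap = S.toLinearMap ∘ₗ (R₁.A q).mulVecLin := by
      refine LinearMap.ext_on hspan₁ ?_
      rintro _ ⟨⟨w, j⟩, rfl⟩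
      have h := hgen (w.snoc q) j
      simp only [Words.snoc, LSS.wordProd_concat, ← Matrix.mulVec_mulVec] at h
      have h' := hgen w.lift j
      simp only [Words.lift] at h'
      simp only [LinearMap.comp_apply, LinearEquiv.coe_coe, Matrix.mulVecLin_apply, h, h']
    exact LinearMap.congr_fun this x
  · have : (R₂.B q).mulVecLin = S.toLinearMap ∘ₗ (R₁.B q).mulVecLin := by
      refine LinearMap.pi_ext' fun j => LinearMap.ext_ring ?_
      simpa [gen] using (hgen₀ (Sum.inr (q, j))).symm
    exact LinearMap.congr_fun this u
  · ext r
    simpa [obsMap_apply, emptyWord] using congrFun (hS x) (emptyWord N, (q, r))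

end Realization

end SwitchedSystem

namespace SwitchedSystem

/-! ### Linear flows and derivatives of curves in subspaces -/

section Flow

variable {E : Type*} [NormedAddCommGroup E] [NormedSpace ℝ E]

/-- The flow `t ↦ exp (t L)` of the linear differential equation `x' = L x`. -/
noncomputable def linearFlow (L : E →L[ℝ] E) (t : ℝ) : E →L[ℝ] E := NormedSpace.exp (t • L)

@[simp]
theorem linearFlow_zero (L : E →L[ℝ] E) : linearFlow L 0 = 1 := by
  simp [linearFlow]

/-- A right derivative of a curve in a closed subspace lies in the subspace. -/
theorem _root_.Submodule.mem_of_hasDerivAt_of_forall_mem {V : Submodule ℝ E}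
    (hV : IsClosed (V : Set E)) {ξ : ℝ → E} {x : E} (hd : HasDerivAt ξ x 0)
    (hmem : ∀ t, 0 ≤ t → ξ t ∈ V) : x ∈ V := by
  have h := (hasDerivWithinAt_iff_tendsto_slope' (Set.self_notMem_Ioi)).1
    (hd.hasDerivWithinAt (s := Set.Ioi 0))
  refine hV.mem_of_tendsto h (Filter.eventually_of_mem self_mem_nhdsWithin fun t ht => ?_)
  rw [slope_def_module]
  exact V.smul_mem _ (V.sub_mem (hmem t (le_of_lt ht)) (hmem 0 le_rfl))

variable [CompleteSpace E]

theorem hasDerivAt_linearFlow_apply (L : E →L[ℝ] E) (x : E) (t : ℝ) :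
    HasDerivAt (fun s => linearFlow L s x) (L (linearFlow L t x)) t := by
  have h := (hasDerivAt_exp_smul_const' (𝕂 := ℝ) L t).clm_apply (hasDerivAt_const t x)
  simpa [linearFlow] using h

/-- A curve that solves `x' = L x` for positive times is determined by its initial value. -/
theorem eq_linearFlow_of_hasDerivAt {L : E →L[ℝ] E} {ξ : ℝ → E}
    (hc : ContinuousOn ξ (Set.Ici 0)) (hd : ∀ s, 0 < s → HasDerivAt ξ (L (ξ s)) s)
    {t : ℝ} (ht : 0 ≤ t) : ξ t = linearFlow L t (ξ 0) := by
  have hL : ∀ s, HasDerivAt (fun r => linearFlow L r) (linearFlow L s * L) s := fun s =>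
    hasDerivAt_exp_smul_const (𝕂 := ℝ) L s
  have hback : ∀ s, HasDerivAt (fun r => linearFlow L (t - r)) (-(linearFlow L (t - s) * L)) s := by
    intro s
    have := (hL (t - s)).scomp s ((hasDerivAt_id s).const_sub t)
    rw [neg_one_smul] at this
    exact this
  rcases ht.eq_or_lt with rfl | ht
  · simp
  -- Pulling back by the flow gives derivative zero on `(0, t)`. Nothing is known about the
  -- derivative of `ξ` at `0`, so constancy is shown on `[s, t]` and `s → 0` is taken by continuity.
  set η : ℝ → E := fun s => linearFlow L (t - s) (ξ s) with hη
  have hηc : ContinuousOn η (Set.Icc 0 t) := by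
    refine ContinuousOn.clm_apply (fun s _ => (hback s).continuousAt.continuousWithinAt) ?_
    exact hc.mono Set.Icc_subset_Ici_self
  have hηd : ∀ s ∈ Set.Ioo 0 t, HasDerivAt η 0 s := by
    intro s hs
    simpa using (hback s).clm_apply (hd s hs.1)
  have hconst : η t = η 0 := by
    have hev : ∀ᶠ s in 𝓝[>] (0 : ℝ), η t = η s := by
      filter_upwards [Ioo_mem_nhdsGT ht] with s hs
      refine constant_of_has_deriv_right_zero (hηc.mono (Set.Icc_subset_Icc_left hs.1.le))
        (fun r hr => ?_) t (Set.right_mem_Icc.2 hs.2.le)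
      exact (hηd r ⟨hs.1.trans_le hr.1, hr.2⟩).hasDerivWithinAt
    have hlim : Filter.Tendsto η (𝓝[>] 0) (𝓝 (η 0)) :=
      ((hηc 0 (Set.left_mem_Icc.2 ht.le)).mono_of_mem_nhdsWithin
        (Filter.mem_of_superset (Ioo_mem_nhdsGT ht) Set.Ioo_subset_Icc_self)).tendsto
    exact tendsto_nhds_unique (tendsto_const_nhds.congr' hev) hlim
  simpa [hη] using hconst

end Flow

/-! ### Reachable span and unobservable subspace -/

namespace LSS

variable {Q : Type*} {n m p : ℕ}

/-- The right-hand side of `(x, s)' = (A_q x + s B_q c, 0)`, the linear system whose solutions with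
`s = 1` are the solutions of mode `q` under the constant input `c`. -/
noncomputable def augmented (S : LSS Q n m p) (q : Q) (c : Fin m → ℝ) :
    ((Fin n → ℝ) × ℝ) →L[ℝ] ((Fin n → ℝ) × ℝ) :=
  LinearMap.toContinuousLinearMap
    (((S.A q).mulVecLin.coprod (LinearMap.toSpanSingleton ℝ _ (S.B q *ᵥ c))).prod 0)

theorem augmented_apply (S : LSS Q n m p) (q : Q) (c : Fin m → ℝ) (x : (Fin n → ℝ) × ℝ) :
    S.augmented q c x = (S.A q *ᵥ x.1 + x.2 • S.B q *ᵥ c, 0) :=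
  rfl

theorem exists_isSolution_const (S : LSS Q n m p) (q : Q) (c : Fin m → ℝ) (x : Fin n → ℝ) :
    ∃ ξ : ℝ → (Fin n → ℝ), ξ 0 = x ∧ (∀ τ, S.IsSolution q (PC.const c) τ ξ) ∧
      HasDerivAt ξ (S.A q *ᵥ x + S.B q *ᵥ c) 0 := by
  have hd : ∀ t, HasDerivAt (fun s => linearFlow (S.augmented q c) s (x, 1)) _ t :=
    hasDerivAt_linearFlow_apply (S.augmented q c) (x, 1)
  have hsnd : ∀ t, HasDerivAt (fun s => (linearFlow (S.augmented q c) s (x, 1)).2) 0 t := fun t =>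
    (ContinuousLinearMap.snd ℝ (Fin n → ℝ) ℝ).hasFDerivAt.comp_hasDerivAt t (hd t)
  have h₂ : ∀ t, (linearFlow (S.augmented q c) t (x, 1)).2 = 1 := by
    intro t
    have h := is_const_of_deriv_eq_zero
      (f := fun s => (linearFlow (S.augmented q c) s (x, 1)).2)
      (fun s => (hsnd s).differentiableAt) (fun s => (hsnd s).deriv) t 0
    simpa using h
  have h₁ : ∀ t, HasDerivAt (fun s => (linearFlow (S.augmented q c) s (x, 1)).1)
      (S.A q *ᵥ (linearFlow (S.augmented q c) t (x, 1)).1 + S.B q *ᵥ c) t := by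
    intro t
    have h := (ContinuousLinearMap.fst ℝ (Fin n → ℝ) ℝ).hasFDerivAt.comp_hasDerivAt t (hd t)
    rw [augmented_apply, h₂, one_smul] at h
    exact h
  refine ⟨fun s => (linearFlow (S.augmented q c) s (x, 1)).1, by simp, fun τ => ⟨?_, ?_⟩, ?_⟩
  · exact fun s _ => (h₁ s).continuousAt.continuousWithinAt
  · exact fun s _ _ => h₁ s
  · simpa using h₁ 0

theorem StateAt.concat_const {S : LSS Q n m p} {c : Fin m → ℝ} {q : Q} {t : ℝ≥0}
    {ξ : ℝ → (Fin n → ℝ)} (hξ : ∀ τ, S.IsSolution q (PC.const c) τ ξ) :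
    ∀ {τ : ℝ≥0} {w : List (Q × ℝ≥0)} {x₀ : Fin n → ℝ},
      S.StateAt (PC.const c) τ w x₀ (ξ 0) → S.StateAt (PC.const c) τ (w ++ [(q, t)]) x₀ (ξ t)
  | τ, [], _, h => ⟨ξ, hξ τ, h, rfl⟩
  | _, (_, _) :: _, _, ⟨η, hη, h0, h⟩ => ⟨η, hη, h0, StateAt.concat_const hξ h⟩

/-- The span of the augmented states `(x, 1)` for `x` reachable from `x₀` under the constant input
`c`. -/
def constReach (S : LSS Q n m p) (c : Fin m → ℝ) (x₀ : Fin n → ℝ) :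
    Submodule ℝ ((Fin n → ℝ) × ℝ) :=
  Submodule.span ℝ {z | ∃ w : SwitchSeq Q, S.IsState x₀ (PC.const c) w z.1 ∧ z.2 = 1}

theorem mem_constReach (S : LSS Q n m p) (c : Fin m → ℝ) (x₀ : Fin n → ℝ) (q : Q) :
    (x₀, 1) ∈ S.constReach c x₀ := by
  obtain ⟨ξ, h0, hξ, -⟩ := S.exists_isSolution_const q c x₀
  -- Switching sequences are non-empty, so the initial state is reached by staying in some mode for
  -- time zero.
  exact Submodule.subset_span ⟨⟨[(q, 0)], by simp⟩, ⟨ξ, hξ 0, h0, by simp [StateAt, h0]⟩, rfl⟩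

/-- Prolonging a run by mode `q` gives a curve inside the span, whose derivative at `0` is the
augmented vector field; finite-dimensional subspaces are closed. -/
theorem augmented_mem_constReach (S : LSS Q n m p) {c : Fin m → ℝ} {x₀ : Fin n → ℝ} (q : Q)
    {z : (Fin n → ℝ) × ℝ} (hz : z ∈ S.constReach c x₀) :
    S.augmented q c z ∈ S.constReach c x₀ := by
  suffices S.constReach c x₀ ≤ (S.constReach c x₀).comap (S.augmented q c).toLinearMap from
    this hz
  refine Submodule.span_le.2 ?_
  rintro ⟨x, s⟩ ⟨w, hw, rfl : s = 1⟩
  obtain ⟨ξ, rfl, hξ, hd⟩ := S.exists_isSolution_const q c x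
  change S.augmented q c (ξ 0, 1) ∈ S.constReach c x₀
  rw [augmented_apply, one_smul]
  refine Submodule.mem_of_hasDerivAt_of_forall_mem (Submodule.closed_of_finiteDimensional _)
    (hd.prodMk (hasDerivAt_const 0 (1 : ℝ))) fun t ht => Submodule.subset_span ?_
  lift t to ℝ≥0 using ht
  exact ⟨⟨w.1 ++ [(q, t)], by simp⟩, StateAt.concat_const hξ hw, rfl⟩

/-- On vectors with second component `0` the input term vanishes, so the augmented field acts as
`A_q`. -/
theorem wordProd_mem_constReach (S : LSS Q n m p) {c : Fin m → ℝ} {x₀ : Fin n → ℝ}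
    (w : List Q) {x : Fin n → ℝ} (hx : (x, 0) ∈ S.constReach c x₀) :
    (S.wordProd w *ᵥ x, 0) ∈ S.constReach c x₀ := by
  induction w using List.reverseRecOn with
  | nil => simpa using hx
  | append_singleton w q ih =>
    have := S.augmented_mem_constReach q ih
    rw [augmented_apply, zero_smul, add_zero, Matrix.mulVec_mulVec] at this
    simpa [LSS.wordProd] using this

theorem mem_span_reach_of_mem_constReach (S : LSS Q n m p) {c : Fin m → ℝ}
    {X₀ : Set (Fin n → ℝ)} {x₀ : Fin n → ℝ} (hx₀ : x₀ ∈ X₀) {z : (Fin n → ℝ) × ℝ}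
    (hz : z ∈ S.constReach c x₀) : z.1 ∈ Submodule.span ℝ (S.reach X₀) := by
  suffices S.constReach c x₀ ≤
      (Submodule.span ℝ (S.reach X₀)).comap (LinearMap.fst ℝ _ _) from this hz
  refine Submodule.span_le.2 ?_
  rintro z ⟨w, hw, -⟩
  exact Submodule.subset_span ⟨x₀, hx₀, _, w, hw⟩

theorem wordProd_mulVec_mem_span_reach (S : LSS Q n m p) {X₀ : Set (Fin n → ℝ)}
    {x₀ : Fin n → ℝ} (hx₀ : x₀ ∈ X₀) (q : Q) (w : List Q) :
    S.wordProd w *ᵥ x₀ ∈ Submodule.span ℝ (S.reach X₀) := by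
  cases w with
  | nil =>
    simpa using S.mem_span_reach_of_mem_constReach hx₀ (S.mem_constReach 0 x₀ q)
  | cons q w =>
    have h := S.augmented_mem_constReach q (S.mem_constReach 0 x₀ q)
    rw [augmented_apply] at h
    have := S.mem_span_reach_of_mem_constReach hx₀ (S.wordProd_mem_constReach w h)
    simpa [LSS.wordProd] using this

/-- Input `c` yields `A_w (A_q x₀ + B_q c)` and input `0` yields `A_w A_q x₀`; the difference is the
vector wanted. -/
theorem wordProd_mulVec_input_mem_span_reach (S : LSS Q n m p) {X₀ : Set (Fin n → ℝ)}
    {x₀ : Fin n → ℝ} (hx₀ : x₀ ∈ X₀) (q : Q) (c : Fin m → ℝ) (w : List Q) :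
    S.wordProd w *ᵥ (S.B q *ᵥ c) ∈ Submodule.span ℝ (S.reach X₀) := by
  have h := S.augmented_mem_constReach q (S.mem_constReach c x₀ q)
  rw [augmented_apply] at h
  have h₁ := S.mem_span_reach_of_mem_constReach hx₀ (S.wordProd_mem_constReach w h)
  have h₂ := S.wordProd_mulVec_mem_span_reach hx₀ q (q :: w)
  have h₃ : S.wordProd (q :: w) *ᵥ x₀ = S.wordProd w *ᵥ (S.A q *ᵥ x₀) := by
    simp [LSS.wordProd]
  rw [h₃] at h₂
  simpa [Matrix.mulVec_add] using Submodule.sub_mem _ h₁ h₂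

/-- The flow of mode `q` under the zero input. -/
noncomputable def modeFlow (S : LSS Q n m p) (q : Q) (t : ℝ) : (Fin n → ℝ) →L[ℝ] (Fin n → ℝ) :=
  linearFlow (LinearMap.toContinuousLinearMap (S.A q).mulVecLin) t

theorem hasDerivAt_modeFlow (S : LSS Q n m p) (q : Q) (x : Fin n → ℝ) (t : ℝ) :
    HasDerivAt (fun s => S.modeFlow q s x) (S.A q *ᵥ S.modeFlow q t x) t :=
  hasDerivAt_linearFlow_apply _ x t

/-- The state-transition map of a switching sequence under the zero input. -/
noncomputable def transition (S : LSS Q n m p) :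
    List (Q × ℝ≥0) → ((Fin n → ℝ) →L[ℝ] (Fin n → ℝ))
  | [] => 1
  | (q, t) :: w => S.transition w ∘L S.modeFlow q t

theorem isSolution_zero_modeFlow (S : LSS Q n m p) (q : Q) (τ : ℝ≥0) (x : Fin n → ℝ) :
    S.IsSolution q (PC.const 0) τ fun s => S.modeFlow q s x :=
  ⟨fun s _ => (S.hasDerivAt_modeFlow q x s).continuousAt.continuousWithinAt,
    fun s _ _ => by simpa [PC.const] using S.hasDerivAt_modeFlow q x s⟩

theorem IsSolution.eq_modeFlow {S : LSS Q n m p} {q : Q} {τ : ℝ≥0} {ξ : ℝ → (Fin n → ℝ)}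
    (h : S.IsSolution q (PC.const 0) τ ξ) (t : ℝ≥0) : ξ t = S.modeFlow q t (ξ 0) := by
  refine eq_linearFlow_of_hasDerivAt h.1 (fun s hs => ?_) t.2
  lift s to ℝ≥0 using hs.le
  simpa [PC.const] using h.2 s (by exact_mod_cast hs) continuousAt_const

/-- Existence and uniqueness of zero-input trajectories. Uniqueness is what lets equality of output
relations be turned into equality of outputs. -/
theorem stateAt_zero_iff (S : LSS Q n m p) (τ : ℝ≥0) (w : List (Q × ℝ≥0))
    (x₀ x : Fin n → ℝ) : S.StateAt (PC.const 0) τ w x₀ x ↔ x = S.transition w x₀ := by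
  induction w generalizing τ x₀ with
  | nil => rfl
  | cons a w ih =>
    obtain ⟨q, t⟩ := a
    constructor
    · rintro ⟨ξ, hξ, rfl, h⟩
      rw [ih, hξ.eq_modeFlow] at h
      exact h
    · intro h
      refine ⟨_, S.isSolution_zero_modeFlow q τ x₀, by simp [modeFlow], ?_⟩
      rw [ih]
      exact h

/-- The states with vanishing output under the zero input. -/
noncomputable def unobservable (S : LSS Q n m p) : Submodule ℝ (Fin n → ℝ) :=
  ⨅ w : SwitchSeq Q, LinearMap.ker
    ((S.C (w.1.getLast w.2).1).mulVecLin ∘ₗ (S.transition w.1).toLinearMap)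

theorem mem_unobservable (S : LSS Q n m p) {x : Fin n → ℝ} :
    x ∈ S.unobservable ↔
      ∀ w : SwitchSeq Q, S.C (w.1.getLast w.2).1 *ᵥ S.transition w.1 x = 0 := by
  simp [unobservable]

theorem Indistinguishable.sub_mem_unobservable {S : LSS Q n m p} {x₁ x₂ : Fin n → ℝ}
    (h : S.Indistinguishable x₁ x₂) : x₁ - x₂ ∈ S.unobservable := by
  rw [mem_unobservable]
  intro w
  obtain ⟨x, hx, hy⟩ := (h (PC.const 0) w _).1
    ⟨S.transition w.1 x₁, (S.stateAt_zero_iff 0 w.1 x₁ _).2 rfl, rfl⟩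
  rw [(S.stateAt_zero_iff 0 w.1 x₂ _).1 hx] at hy
  rw [map_sub, Matrix.mulVec_sub, hy, sub_self]

/-- Unobservability persists along the zero-input flow, since time spent in `q` can be prefixed to
any switching sequence; differentiate at `0`. -/
theorem mulVec_mem_unobservable (S : LSS Q n m p) (q : Q) {x : Fin n → ℝ}
    (hx : x ∈ S.unobservable) : S.A q *ᵥ x ∈ S.unobservable := by
  have hd := S.hasDerivAt_modeFlow q x 0
  have h0 : S.modeFlow q 0 x = x := by simp [modeFlow]
  rw [h0] at hd
  refine Submodule.mem_of_hasDerivAt_of_forall_mem (Submodule.closed_of_finiteDimensional _) hd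
    fun t ht => ?_
  lift t to ℝ≥0 using ht
  rw [mem_unobservable] at hx ⊢
  intro w
  have := hx ⟨(q, t) :: w.1, by simp⟩
  simpa [transition, List.getLast_cons w.2] using this

theorem wordProd_mem_unobservable (S : LSS Q n m p) (w : List Q) {x : Fin n → ℝ}
    (hx : x ∈ S.unobservable) : S.wordProd w *ᵥ x ∈ S.unobservable := by
  induction w generalizing x with
  | nil => simpa [LSS.wordProd] using hx
  | cons q w ih => simpa [LSS.wordProd] using ih (S.mulVec_mem_unobservable q hx)

theorem output_eq_zero_of_mem_unobservable (S : LSS Q n m p) (q : Q) {x : Fin n → ℝ}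
    (hx : x ∈ S.unobservable) : S.C q *ᵥ x = 0 := by
  simpa [transition, modeFlow] using S.mem_unobservable.1 hx ⟨[(q, 0)], by simp⟩

end LSS

end SwitchedSystem

namespace SwitchedSystem

/-! ### From rank conditions to semi-reachability and observability -/

namespace Realization

variable {Q : Type*} {m p n : ℕ} {Φ : Set (IOMap Q m p)} {f₀ : Φ}

theorem isSemiReachable_of_genSpan_eq_top [Nonempty Q] (R : Realization Φ n) (f₀ : Φ) {M : ℕ}
    (h : R.genSpan M = ⊤) : R.IsSemiReachable := by
  obtain ⟨q⟩ := ‹Nonempty Q›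
  rw [IsSemiReachable, LSS.IsSemiReachableFrom, eq_top_iff, ← h]
  refine Submodule.span_le.2 ?_
  rintro _ ⟨⟨w, f | ⟨q₀, j⟩⟩, rfl⟩
  · exact R.wordProd_mulVec_mem_span_reach (Set.mem_range_self f) q w.1
  · have := R.wordProd_mulVec_input_mem_span_reach (Set.mem_range_self (f := R.μ) f₀) q₀
      (Pi.single j 1) w.1
    rwa [Matrix.mulVec_single_one] at this

theorem isObservable_of_ker_obsMap_eq_bot (R : Realization Φ n) {L : ℕ}
    (h : LinearMap.ker (R.obsMap L) = ⊥) : R.IsObservable := by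
  intro x₁ x₂ hx
  rw [← sub_eq_zero, ← Submodule.mem_bot ℝ, ← h, LinearMap.mem_ker]
  ext ⟨v, q, r⟩
  exact congrFun (R.output_eq_zero_of_mem_unobservable q
    (R.wordProd_mem_unobservable v.1 hx.sub_mem_unobservable)) r

theorem hankelRank_eq_zero_of_isEmpty [IsEmpty Q] (Φ : Set (IOMap Q m p)) (f₀ : Φ) (L M : ℕ) :
    hankelRank Φ f₀ L M = 0 :=
  Module.finrank_zero_of_subsingleton

end Realization

end SwitchedSystem

open SwitchedSystem SwitchedSystem.Realization

theorem theorem2 {Q : Type*} [Finite Q] {m p : ℕ}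
    (Φ : Set (SwitchedSystem.IOMap Q m p)) (f₀ : Φ)
    (hΦ : SwitchedSystem.HasGeneralizedKernelRepresentation Φ)
    (N : ℕ) (hN : 0 < N)
    (hrow : SwitchedSystem.hankelRank Φ f₀ N N = SwitchedSystem.hankelRank Φ f₀ (N + 1) N)
    (hcol : SwitchedSystem.hankelRank Φ f₀ (N + 1) N =
      SwitchedSystem.hankelRank Φ f₀ N (N + 1)) :
    ((∃ (n : ℕ) (R : SwitchedSystem.Realization Φ n),
        R.IsMinimalPartialRealization f₀ (2 * N + 1)) ∧
      ∀ φ : SwitchedSystem.colSpace Φ f₀ N (N + 1) ≃ₗ[ℝ]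
          (Fin (SwitchedSystem.hankelRank Φ f₀ N (N + 1)) → ℝ),
        (∃! R : SwitchedSystem.Realization Φ (SwitchedSystem.hankelRank Φ f₀ N (N + 1)),
          R.IsAlgorithmOutput f₀ N φ) ∧
        ∀ R : SwitchedSystem.Realization Φ (SwitchedSystem.hankelRank Φ f₀ N (N + 1)),
          R.IsAlgorithmOutput f₀ N φ → R.IsMinimalPartialRealization f₀ (2 * N + 1)) ∧
    (∀ (n : ℕ) (R : SwitchedSystem.Realization Φ n),
      R.IsMinimalPartialRealization f₀ (2 * N + 1) →
        R.IsSemiReachable ∧ R.IsObservable ∧ n = SwitchedSystem.hankelRank Φ f₀ N N) ∧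
    (∀ (n₁ n₂ : ℕ) (R₁ : SwitchedSystem.Realization Φ n₁) (R₂ : SwitchedSystem.Realization Φ n₂),
      R₁.IsMinimalPartialRealization f₀ (2 * N + 1) →
      R₂.IsMinimalPartialRealization f₀ (2 * N + 1) →
        R₁.Isomorphic R₂) := by
  have hNN : hankelRank Φ f₀ N N = hankelRank Φ f₀ N (N + 1) := hrow.trans hcol
  have hmin : ∀ φ : colSpace Φ f₀ N (N + 1) ≃ₗ[ℝ] (Fin (hankelRank Φ f₀ N (N + 1)) → ℝ),
      ∀ R : Realization Φ (hankelRank Φ f₀ N (N + 1)),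
        R.IsAlgorithmOutput f₀ N φ → R.IsMinimalPartialRealization f₀ (2 * N + 1) :=
    fun φ R hR => ⟨hR.isPartialRealization hNN,
      fun n' R' hR' => hR'.hankelRank_le (by omega)⟩
  have hex : ∃ R : Realization Φ (hankelRank Φ f₀ N (N + 1)),
      R.IsMinimalPartialRealization f₀ (2 * N + 1) := by
    let φ : colSpace Φ f₀ N (N + 1) ≃ₗ[ℝ] (Fin (hankelRank Φ f₀ N (N + 1)) → ℝ) :=
      LinearEquiv.ofFinrankEq _ _ (Module.finrank_fin_fun ℝ).symm
    obtain ⟨R, hR, -⟩ := existsUnique_isAlgorithmOutput hrow hNN φ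
    exact ⟨R, hmin φ R hR⟩
  have hdim : ∀ (n : ℕ) (R : Realization Φ n),
      R.IsMinimalPartialRealization f₀ (2 * N + 1) → n = hankelRank Φ f₀ N N := by
    intro n R hR
    obtain ⟨R₀, hR₀⟩ := hex
    exact le_antisymm ((hR.2 _ R₀ hR₀.1).trans hNN.ge) (hR.1.hankelRank_le (by omega))
  refine ⟨⟨⟨_, hex⟩, fun φ => ⟨existsUnique_isAlgorithmOutput hrow hNN φ, hmin φ⟩⟩,
    fun n R hR => ⟨?_, ?_, hdim n R hR⟩, fun n₁ n₂ R₁ R₂ h₁ h₂ =>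
      isomorphic_of_eq_hankelRank h₁.1 h₂.1 (hdim _ _ h₁) (hdim _ _ h₂)⟩
  -- Without modes there are no switching sequences and nothing is reachable; the claim then holds
  -- because the Hankel matrix has no rows, so the dimension is zero.
  · rcases isEmpty_or_nonempty Q with hQ | hQ
    · have hn : n = 0 := (hdim n R hR).trans (hankelRank_eq_zero_of_isEmpty Φ f₀ N N)
      subst hn
      exact Subsingleton.elim _ _
    · exact R.isSemiReachable_of_genSpan_eq_top f₀
        (hR.1.genSpan_eq_top (L := N) (M := N) (by omega) (hdim n R hR))
  · exact R.isObservable_of_ker_obsMap_eq_bot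
      (hR.1.ker_obsMap_eq_bot (L := N) (M := N) (by omega) (hdim n R hR))
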